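/- Let $\mathbb{K}$ be a field and let $G$ be a finite, simple, connected graph with vertex set $V=\{1,\dots,\ell\}$. Let $S=\mathbb{K}[x_1,\dots,x_\ell]$, let $\partial_i$ be the partial derivative with respect to $x_i$, and let $\mathcal{A}(G)=\{\ker(x_i-x_j) \mid \{i,j\}\in E(G)\}$ be the graphic arrangement of $G$ in $\mathbb{K}^\ell$. Let \[D(\mathcal{A}(G))=\{\theta\in \mathrm{Der}_{\mathbb{K}}(S) \mid \theta(\alpha_H)\in \alpha_H S \text{ for all } H\in\mathcal{A}(G)\}\] be its $S$-module of logarithmic derivations, where $\alpha_H$ is a linear form with kernel $H$. Let $\kappa$ be the (vertex) connectivity of $G$, i.e. the greatest integer $k\ge 0$ such that $|V|>k$ and $G\setminus X$ is connected for every $X\subseteq V$ with $|X|<k$. For $k\ge 0$ put $\theta_k=\sum_{i=1}^{\ell} x_i^k\,\partial_i$. A separator of $G$ is a set $T\subseteq V$ such that $G\setminus T$ contains two vertices that are not joined by a path in $G\setminus T$. For a separator $T$ and a connected component $C$ of $G\setminus T$, the associated separator-based derivation is $\theta_C^T=\sum_{i\in C}\prod_{t\in T}(x_i-x_t)\,\partial_i$.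 Then there exists a finite set $F$ of separator-based derivations of $G$ such that $\{\theta_0,\dots,\theta_\kappa\}\cup F$ is a minimal generating set of the $S$-module $D(\mathcal{A}(G))$, i.e. it generates $D(\mathcal{A}(G))$ and no proper subset of it does. -/

import Mathlib

noncomputable section

namespace GraphicArrangement

/-! ### Graphs: connectivity and separators -/

section Graph

variable {V : Type*} [Fintype V]

/-- `G` is `k`-connected: it has more than `k` vertices, and removing fewer than `k` vertices
leaves a connected graph. -/
def IsKConnected (G : SimpleGraph V) (k : ℕ) : Prop :=
  k < Fintype.card V ∧
    ∀ X : Finset V, X.card < k → (G.induce ((X : Set V)ᶜ)).Connected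

/-- The (vertex) connectivity of `G`: the greatest `k` such that `G` is `k`-connected. -/
def connectivity (G : SimpleGraph V) : ℕ :=
  sSup {k : ℕ | IsKConnected G k}

/-- For a graph with at least one vertex the supremum above is attained. -/
theorem isGreatest_connectivity [Nonempty V] (G : SimpleGraph V) :
    IsGreatest {k : ℕ | IsKConnected G k} (connectivity G) := by
  have hb : BddAbove {k : ℕ | IsKConnected G k} :=
    ⟨Fintype.card V, fun k hk => hk.1.le⟩
  have hne : {k : ℕ | IsKConnected G k}.Nonempty :=
    ⟨0, Fintype.card_pos, fun X hX => absurd hX (Nat.not_lt_zero _)⟩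
  exact ⟨Nat.sSup_mem hne hb, fun k hk => le_csSup hb hk⟩

/-- `T` is a separator of `G`: the graph `G ∖ T` has two vertices not joined by a path. -/
def IsSeparator (G : SimpleGraph V) (T : Finset V) : Prop :=
  ¬ (G.induce ((T : Set V)ᶜ)).Preconnected

/-- `C` is (the vertex set of) a connected component of `G ∖ T`. -/
def IsComponentOfDelete (G : SimpleGraph V) (T C : Finset V) : Prop :=
  ∃ c : (G.induce ((T : Set V)ᶜ)).ConnectedComponent, (C : Set V) = Subtype.val '' c.supp

end Graph

/-! ### Arrangements and their modules of logarithmic derivations -/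

section Arrangement

variable (K : Type*) [Field K] {V : Type*} [Fintype V]

/-- The graphic arrangement of `G` in the vector space `K^V`: the set of all hyperplanes
`ker (x_i - x_j)` for edges `{i, j}` of `G`. -/
def graphicArrangement (G : SimpleGraph V) : Set (Submodule K (V → K)) :=
  {H | ∃ i j : V, G.Adj i j ∧
    H = LinearMap.ker ((LinearMap.proj i : (V → K) →ₗ[K] K) - LinearMap.proj j)}

variable {K}

/-- A linear form on `K^V`, viewed as a homogeneous polynomial of degree one. -/
def formPoly (α : (V → K) →ₗ[K] K) : MvPolynomial V K :=
  open Classical in ∑ i, MvPolynomial.C (α (Pi.single i 1)) * MvPolynomial.X i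

/-- The module `D(A)` of logarithmic derivations of a set `A` of hyperplanes in `K^V`: all
`K`-derivations `θ` of the polynomial ring such that `α` divides `θ α` for every linear form `α`
whose kernel belongs to `A`. (The form of a hyperplane is unique up to a nonzero scalar.) -/
def logDerivations (A : Set (Submodule K (V → K))) :
    Submodule (MvPolynomial V K) (Derivation K (MvPolynomial V K) (MvPolynomial V K)) where
  carrier := {θ | ∀ α : (V → K) →ₗ[K] K, LinearMap.ker α ∈ A → formPoly α ∣ θ (formPoly α)}
  add_mem' := fun ha hb α hα => by
    rw [Derivation.add_apply]
    exact dvd_add (ha α hα) (hb α hα)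
  zero_mem' := fun α _ => by
    rw [Derivation.zero_apply]
    exact dvd_zero _
  smul_mem' := fun c θ hθ α hα => by
    rw [Derivation.smul_apply, smul_eq_mul]
    exact (hθ α hα).mul_left c

variable (K)

/-- The derivation `θ_k = ∑ i, x_i ^ k ∂_i`. -/
def powerDerivation (V : Type*) [Fintype V] (k : ℕ) :
    Derivation K (MvPolynomial V K) (MvPolynomial V K) :=
  ∑ i : V, (MvPolynomial.X i ^ k : MvPolynomial V K) • MvPolynomial.pderiv i

/-- The derivation `θ_C^T = ∑ i ∈ C, (∏ t ∈ T, (x_i - x_t)) ∂_i`. -/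
def separatorDerivation (T C : Finset V) :
    Derivation K (MvPolynomial V K) (MvPolynomial V K) :=
  ∑ i ∈ C, (∏ t ∈ T, (MvPolynomial.X i - MvPolynomial.X t) : MvPolynomial V K) •
    MvPolynomial.pderiv i

/-- The separator-based derivations of `G`: all `θ_C^T` with `T` a separator of `G` and `C` a
connected component of `G ∖ T`. -/
def separatorBasedDerivations (G : SimpleGraph V) :
    Set (Derivation K (MvPolynomial V K) (MvPolynomial V K)) :=
  {δ | ∃ T C : Finset V, IsSeparator G T ∧ IsComponentOfDelete G T C ∧
    δ = separatorDerivation K T C}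

end Arrangement

/-- `B` is a minimal generating set of the submodule `N`: it generates `N`, and no proper subset
of `B` does. -/
def IsMinimalGeneratingSet {R M : Type*} [Semiring R] [AddCommMonoid M] [Module R M]
    (N : Submodule R M) (B : Set M) : Prop :=
  Minimal (fun B' : Set M => Submodule.span R B' = N) B

end GraphicArrangement

end

namespace GraphicArrangement

open MvPolynomial

/-! ### Membership in the module, edge by edge -/

section Generators

variable {K : Type*} [Field K] {V : Type*} [Fintype V]

/-! Generation. For the complete graph, Newton interpolation writes any logarithmic derivation as a
combination of the `θ_k` with `k < ℓ`. In general, non-edges are added one at a time: if `i`, `j`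
are not adjacent, subtracting from `θ` a combination of separator-based derivations makes `x_i -
x_j` divide `θ(x_i) - θ(x_j)`, so the difference is logarithmic for `G + ij`
(`exists_mem_span_separatorBasedDerivations_dvd`). Separator-based derivations of the larger graph
are sums of such derivations of `G`. The `θ_m` with `κ < m < ℓ` are superfluous: separators yield a
derivation whose coefficients are the values at the `x_i` of a monic polynomial of degree `m`, hence
`θ_m` plus a combination of lower `θ_k` (`powerDerivation_mem_of_monic`).

Minimality. Take `F` inclusion-minimal among the finite sets of separator-based derivations that
generate together with `θ_0, …, θ_κ`. Then no element of `F` can be dropped. Suppose `θ_k` could be.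
Separators have at least `κ ≥ k` vertices, so the degree `k` part of the relation gives `θ_k = η +
c`, with `η` in the span of the lower `θ_j` and `c` a `K`-combination of `F`. If `c` has a nonzero
coefficient, an element of `F` is redundant; otherwise `θ_0, …, θ_k` are dependent although `k < ℓ`.
Both are impossible. -/

theorem _root_.Derivation.finset_sum_apply {R A M ι : Type*} [CommSemiring R] [CommSemiring A]
    [AddCommMonoid M] [Algebra R A] [Module A M] [Module R M] (s : Finset ι)
    (D : ι → Derivation R A M) (a : A) : (∑ i ∈ s, D i) a = ∑ i ∈ s, D i a := by
  rw [← Derivation.coeFnAddMonoidHom_apply, map_sum, Finset.sum_apply]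
  rfl

@[simp]
theorem powerDerivation_X (k : ℕ) (i : V) :
    powerDerivation K V k (X i) = X i ^ k := by
  classical
  simp [powerDerivation, Derivation.finset_sum_apply, pderiv_X, Pi.single_apply]

omit [Fintype V] in
open Classical in
@[simp]
theorem separatorDerivation_X (T C : Finset V) (i : V) :
    separatorDerivation K T C (X i) =
      if i ∈ C then ∏ t ∈ T, (X i - X t : MvPolynomial V K) else 0 := by
  simp [separatorDerivation, Derivation.finset_sum_apply, pderiv_X, Pi.single_apply]

theorem mem_logDerivations_iff (G : SimpleGraph V)
    (θ : Derivation K (MvPolynomial V K) (MvPolynomial V K)) :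
    θ ∈ logDerivations (graphicArrangement K G) ↔
      ∀ i j, G.Adj i j → (X i - X j : MvPolynomial V K) ∣ θ (X i) - θ (X j) := by
  classical
  -- The definition tests every form with the given kernel; each one is a scalar multiple of `x_i -
  -- x_j`.
  have form_eq : ∀ (i j : V) (α : (V → K) →ₗ[K] K), i ≠ j →
      (∀ k, α (Pi.single k 1) = if k = i then α (Pi.single i 1) else
        if k = j then - α (Pi.single i 1) else 0) →
      formPoly α = C (α (Pi.single i 1)) * (X i - X j : MvPolynomial V K) := by
    intro i j α hij h
    unfold formPoly
    have : ∀ k, (C (α (Pi.single k 1)) * X k : MvPolynomial V K) =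
        (if k = i then C (α (Pi.single i 1)) * X i else 0) -
          (if k = j then C (α (Pi.single i 1)) * X j else 0) := by
      intro k
      rw [h k]
      by_cases h1 : k = i
      · subst h1
        simp [hij]
      · by_cases h2 : k = j
        · subst h2
          simp [h1]
        · simp [h1, h2]
    trans ∑ k, (C (α (Pi.single k 1)) * X k : MvPolynomial V K)
    · congr!
    · rw [Finset.sum_congr rfl fun k _ => this k, Finset.sum_sub_distrib, mul_sub]
      simp
  constructor
  · intro h i j hij
    have h1 := h ((LinearMap.proj i : (V → K) →ₗ[K] K) - LinearMap.proj j) ⟨i, j, hij, rfl⟩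
    rw [form_eq i j _ hij.ne] at h1
    · simpa [hij.ne] using h1
    · intro k
      by_cases h1 : k = i
      · subst h1; simp
      · by_cases h2 : k = j
        · subst h2
          simp [hij.ne, hij.ne']
        · simp [h1, h2, Ne.symm h1, Ne.symm h2]
  · rintro h α ⟨i, j, hij, hα⟩
    have hne := hij.ne
    have key : ∀ x : V → K, x i = x j → α x = 0 := by
      intro x hx
      have : x ∈ LinearMap.ker α := by
        rw [hα]
        simp [hx]
      exact this
    rw [form_eq i j α hne]
    · rw [Derivation.leibniz, map_sub]
      simp only [derivation_C, smul_eq_mul, mul_zero, add_zero]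
      exact mul_dvd_mul_left _ (h i j hij)
    · intro k
      by_cases h1 : k = i
      · simp [h1]
      · by_cases h2 : k = j
        · subst h2
          -- The vector `e_i + e_j` lies on the hyperplane, so the two coefficients are opposite.
          have := key (Pi.single i 1 + Pi.single k 1) (by simp [h1, hne])
          rw [map_add] at this
          simp only [h1, if_false, if_true]
          exact eq_neg_of_add_eq_zero_right this
        · simp only [h1, h2, if_false]
          exact key _ (by simp [Ne.symm h1, Ne.symm h2])

theorem powerDerivation_mem_logDerivations (G : SimpleGraph V) (k : ℕ) :
    powerDerivation K V k ∈ logDerivations (graphicArrangement K G) := by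
  rw [mem_logDerivations_iff]
  intro i j _
  simpa using sub_dvd_pow_sub_pow _ _ k

end Generators

/-! ### Separators and unions of components -/

section Components

variable {V : Type*} {G : SimpleGraph V}

/-- `A` is a union of vertex sets of connected components of `G ∖ T`. -/
def IsUnionOfComponents (G : SimpleGraph V) (T A : Finset V) : Prop :=
  Disjoint A T ∧ ∀ u ∈ A, ∀ v, v ∉ T → G.Adj u v → v ∈ A

theorem IsUnionOfComponents.mem_of_reachable {T A : Finset V} (hA : IsUnionOfComponents G T A)
    {u v : ((T : Set V)ᶜ : Set V)} (h : (G.induce ((T : Set V)ᶜ)).Reachable u v)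
    (hu : (u : V) ∈ A) : (v : V) ∈ A := by
  obtain ⟨p⟩ := h
  induction p with
  | nil => exact hu
  | @cons a b c hab _ ih =>
    exact ih (hA.2 _ hu _ (fun hb => b.2 hb) hab)

theorem exists_isComponentOfDelete [Finite V] (G : SimpleGraph V) {T : Finset V}
    (v : ((T : Set V)ᶜ : Set V)) :
    ∃ C : Finset V, IsComponentOfDelete G T C ∧
      ∀ u : ((T : Set V)ᶜ : Set V), (u : V) ∈ C ↔ (G.induce ((T : Set V)ᶜ)).Reachable v u := by
  classical
  let c := (G.induce ((T : Set V)ᶜ)).connectedComponentMk v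
  refine ⟨(Set.toFinite (Subtype.val '' c.supp)).toFinset, ⟨c, by simp⟩, fun u => ?_⟩
  rw [Set.Finite.mem_toFinset, Subtype.val_injective.mem_set_image,
    SimpleGraph.ConnectedComponent.mem_supp_iff, SimpleGraph.ConnectedComponent.eq]
  exact ⟨fun h => h.symm, fun h => h.symm⟩

theorem IsComponentOfDelete.isUnionOfComponents {T C : Finset V}
    (h : IsComponentOfDelete G T C) : IsUnionOfComponents G T C := by
  obtain ⟨c, hc⟩ := h
  have hmem : ∀ u, u ∈ C ↔ ∃ hu : u ∈ ((T : Set V)ᶜ : Set V), ⟨u, hu⟩ ∈ c.supp := by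
    intro u
    rw [← Finset.mem_coe, hc]
    simp
  constructor
  · rw [Finset.disjoint_left]
    intro u hu
    obtain ⟨h, -⟩ := (hmem u).1 hu
    simpa using h
  · intro u hu v hv huv
    obtain ⟨h, h'⟩ := (hmem u).1 hu
    refine (hmem v).2 ⟨by simpa using hv, ?_⟩
    refine SimpleGraph.ConnectedComponent.mem_supp_of_adj_mem_supp _ h' ?_
    simpa using huv

theorem IsUnionOfComponents.mono {H : SimpleGraph V} (h : G ≤ H) {T A : Finset V}
    (hA : IsUnionOfComponents H T A) : IsUnionOfComponents G T A :=
  ⟨hA.1, fun u hu v hv huv => hA.2 u hu v hv (h huv)⟩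

theorem IsSeparator.mono {H : SimpleGraph V} (h : G ≤ H) {T : Finset V}
    (hT : IsSeparator H T) : IsSeparator G T :=
  fun hG => hT (hG.mono fun _ _ huv => h huv)

theorem IsSeparator.exists_not_reachable {T : Finset V} (hT : IsSeparator G T) :
    ∃ u v : ((T : Set V)ᶜ : Set V), ¬ (G.induce ((T : Set V)ᶜ)).Reachable u v := by
  simpa [IsSeparator, SimpleGraph.Preconnected] using hT

theorem not_reachable_of_subset {T T' : Finset V} (h : T ⊆ T') {u v : V} (hu : u ∉ T')
    (hv : v ∉ T')
    (huv : ¬ (G.induce ((T : Set V)ᶜ)).Reachable ⟨u, by simpa using fun h' => hu (h h')⟩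
      ⟨v, by simpa using fun h' => hv (h h')⟩) :
    ¬ (G.induce ((T' : Set V)ᶜ)).Reachable ⟨u, by simpa using hu⟩ ⟨v, by simpa using hv⟩ := by
  intro hr
  apply huv
  have hsub : ((T' : Set V)ᶜ : Set V) ≤ ((T : Set V)ᶜ : Set V) :=
    Set.compl_subset_compl.2 (by exact_mod_cast h)
  exact hr.map (SimpleGraph.induceHomOfLE G hsub).toHom

theorem card_ge_connectivity_of_isSeparator [Fintype V] [Nonempty V] {T : Finset V} (hT : IsSeparator G T) :
    connectivity G ≤ T.card := by
  by_contra! h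
  exact hT ((isGreatest_connectivity G).1.2 T h).preconnected

theorem exists_isSeparator_card_le [Fintype V] [Nonempty V]
    (h : connectivity G + 1 < Fintype.card V) :
    ∃ T : Finset V, IsSeparator G T ∧ T.card ≤ connectivity G := by
  have h1 : ¬ IsKConnected G (connectivity G + 1) := by
    intro h'
    have := (isGreatest_connectivity G).2 h'
    omega
  simp only [IsKConnected, not_and, not_forall] at h1
  obtain ⟨T, hT, hT'⟩ := h1 h
  refine ⟨T, fun hp => hT' ?_, by omega⟩
  -- Failure of connectedness means a separator only once `G ∖ T` is known to be nonempty.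
  obtain ⟨v, hv⟩ : ∃ v, v ∉ T := by
    by_contra! hall
    have : T = Finset.univ := Finset.eq_univ_iff_forall.2 hall
    rw [this, Finset.card_univ] at hT
    omega
  exact { preconnected := hp, nonempty := ⟨⟨v, by simpa using hv⟩⟩ }

end Components

/-! ### The complete graph, by Newton interpolation -/

section Interpolation

variable {K : Type*} [Field K] {V : Type*}

theorem prime_X_sub_X {i j : V} (hij : i ≠ j) : Prime (X i - X j : MvPolynomial V K) := by
  classical
  rw [← irreducible_iff_prime]
  have hcoeff : coeff (Finsupp.single i 1) (X i - X j : MvPolynomial V K) = 1 := by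
    simp [coeff_X, Finsupp.single_left_inj, hij.symm]
  apply irreducible_of_totalDegree_eq_one
  · have hh : (X i - X j : MvPolynomial V K).IsHomogeneous 1 :=
      (isHomogeneous_X K i).sub (isHomogeneous_X K j)
    refine hh.totalDegree fun h => ?_
    rw [h] at hcoeff
    simp at hcoeff
  · intro x hx
    exact isUnit_of_dvd_one (hcoeff ▸ hx (Finsupp.single i 1))

theorem isRelPrime_X_sub_X {i j l : V} (hij : i ≠ j) (hil : i ≠ l) (hjl : j ≠ l) :
    IsRelPrime (X i - X j : MvPolynomial V K) (X i - X l) := by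
  classical
  rw [(prime_X_sub_X hij).irreducible.isRelPrime_iff_not_dvd]
  intro h
  -- At this point `x_i - x_j` vanishes and `x_i - x_l` does not.
  have := map_dvd (aeval fun k : V => if k = l then (1 : K) else 0) h
  simp [hil, hjl] at this

/-- Newton's scheme without denominators: the next coefficient exists because the factors `x_a -
x_i` are pairwise coprime and each divides the error at `x_a`. -/
theorem exists_polynomial_interpolation (f : V → MvPolynomial V K)
    (hf : ∀ i j, i ≠ j → (X i - X j : MvPolynomial V K) ∣ f i - f j) (A : Finset V) :
    ∃ p : Polynomial (MvPolynomial V K), p.degree < (A.card : WithBot ℕ) ∧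
      ∀ i ∈ A, p.eval (X i) = f i := by
  classical
  induction A using Finset.induction_on with
  | empty => exact ⟨0, by simp, by simp⟩
  | insert a A ha ih =>
    obtain ⟨p, hp, hpA⟩ := ih
    have hne : ∀ i ∈ A, a ≠ i := fun i hi h => ha (h ▸ hi)
    have hdvd : (∏ i ∈ A, (X a - X i) : MvPolynomial V K) ∣ f a - p.eval (X a) := by
      apply Finset.prod_dvd_of_isRelPrime
      · intro i hi j hj hij
        exact isRelPrime_X_sub_X (hne i hi) (hne j hj) hij
      · intro i hi
        have h1 := hf a i (hne i hi)
        have h2 := Polynomial.sub_dvd_eval_sub (X a : MvPolynomial V K) (X i) p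
        rw [hpA i hi] at h2
        simpa using dvd_sub h1 h2
    obtain ⟨c, hc⟩ := hdvd
    have hdeg : (∏ i ∈ A, (Polynomial.X - Polynomial.C (X i : MvPolynomial V K))).degree =
        (A.card : WithBot ℕ) := by
      simp [Polynomial.degree_prod]
    refine ⟨p + Polynomial.C c * ∏ i ∈ A, (Polynomial.X - Polynomial.C (X i)), ?_, ?_⟩
    · rw [Finset.card_insert_of_notMem ha]
      have hlt : (A.card : WithBot ℕ) < ((A.card + 1 : ℕ) : WithBot ℕ) := by
        exact_mod_cast Nat.lt_succ_self _
      refine lt_of_le_of_lt (Polynomial.degree_add_le _ _) (max_lt (hp.trans hlt) ?_)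
      refine lt_of_le_of_lt ?_ hlt
      rw [← hdeg]
      calc _ ≤ _ := Polynomial.degree_mul_le _ _
        _ ≤ 0 + _ := by gcongr; exact Polynomial.degree_C_le
        _ = _ := zero_add _
    · intro i hi
      rw [Polynomial.eval_add, Polynomial.eval_mul, Polynomial.eval_C, Polynomial.eval_prod]
      simp only [Polynomial.eval_sub, Polynomial.eval_X, Polynomial.eval_C]
      rcases Finset.mem_insert.1 hi with rfl | hi
      · linear_combination -hc
      · rw [hpA i hi, Finset.prod_eq_zero hi (sub_self _), mul_zero, add_zero]

variable [Fintype V]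

theorem eq_sum_smul_powerDerivation {δ : Derivation K (MvPolynomial V K) (MvPolynomial V K)}
    (p : Polynomial (MvPolynomial V K)) {n : ℕ} (hn : p.natDegree < n)
    (h : ∀ i, δ (X i) = p.eval (X i)) :
    δ = ∑ k ∈ Finset.range n, p.coeff k • powerDerivation K V k := by
  apply derivation_ext
  intro i
  rw [h, Derivation.finset_sum_apply, Polynomial.eval_eq_sum_range' hn]
  simp

theorem mem_span_powerDerivation_of_eval
    {δ : Derivation K (MvPolynomial V K) (MvPolynomial V K)}
    (p : Polynomial (MvPolynomial V K)) {n : ℕ} (hn : p.degree < (n : WithBot ℕ))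
    (h : ∀ i, δ (X i) = p.eval (X i)) :
    δ ∈ Submodule.span (MvPolynomial V K) {θ | ∃ k < n, θ = powerDerivation K V k} := by
  have key : δ = ∑ k ∈ Finset.range n, p.coeff k • powerDerivation K V k := by
    rcases eq_or_ne p 0 with rfl | hp
    · apply derivation_ext
      intro i
      rw [h, Derivation.finset_sum_apply]
      simp
    · exact eq_sum_smul_powerDerivation p ((Polynomial.natDegree_lt_iff_degree_lt hp).2 hn) h
  rw [key]
  exact Submodule.sum_mem _ fun k hk => Submodule.smul_mem _ _
    (Submodule.subset_span ⟨k, Finset.mem_range.1 hk, rfl⟩)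

theorem logDerivations_top_le_span :
    logDerivations (graphicArrangement K (⊤ : SimpleGraph V)) ≤
      Submodule.span (MvPolynomial V K)
        {θ | ∃ k < Fintype.card V, θ = powerDerivation K V k} := by
  intro θ hθ
  rw [mem_logDerivations_iff] at hθ
  obtain ⟨p, hp, hpV⟩ := exists_polynomial_interpolation (fun i => θ (X i))
    (fun i j hij => hθ i j hij) Finset.univ
  exact mem_span_powerDerivation_of_eval p hp fun i => (hpV i (Finset.mem_univ i)).symm

end Interpolation

/-! ### Derivations attached to separators -/

section Separators

variable {K : Type*} [Field K] {V : Type*} [Fintype V] {G : SimpleGraph V}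

theorem separatorDerivation_mem_logDerivations {T A : Finset V}
    (hA : IsUnionOfComponents G T A) :
    separatorDerivation K T A ∈ logDerivations (graphicArrangement K G) := by
  rw [mem_logDerivations_iff]
  have key : ∀ i j, G.Adj i j → i ∈ A → (X i - X j : MvPolynomial V K) ∣
      separatorDerivation K T A (X i) - separatorDerivation K T A (X j) := by
    intro i j hij hi
    by_cases hj : j ∈ A
    · simp only [separatorDerivation_X, hi, hj, if_true]
      have := Polynomial.sub_dvd_eval_sub (X i : MvPolynomial V K) (X j)
        (∏ t ∈ T, (Polynomial.X - Polynomial.C (X t : MvPolynomial V K)))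
      simpa [Polynomial.eval_prod] using this
    · have hjT : j ∈ T := by
        by_contra h
        exact hj (hA.2 i hi j h hij)
      simp only [separatorDerivation_X, hi, hj, if_true, if_false, sub_zero]
      exact Finset.dvd_prod_of_mem (fun t => (X i - X t : MvPolynomial V K)) hjT
  intro i j hij
  by_cases hi : i ∈ A
  · exact key i j hij hi
  · by_cases hj : j ∈ A
    · have := key j i hij.symm hj
      rwa [dvd_sub_comm, ← neg_sub (X j), neg_dvd]
    · simp [hi, hj]

/-- The derivation is additive in `A`, so components can be peeled off one at a time. -/
theorem separatorDerivation_mem_span {T A : Finset V} (hT : IsSeparator G T)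
    (hA : IsUnionOfComponents G T A) :
    separatorDerivation K T A ∈
      Submodule.span (MvPolynomial V K) (separatorBasedDerivations K G) := by
  classical
  induction hn : A.card using Nat.strong_induction_on generalizing A with
  | _ n ih =>
    subst hn
    rcases A.eq_empty_or_nonempty with rfl | ⟨v, hv⟩
    · simp [separatorDerivation]
    · have hvT : v ∉ T := Finset.disjoint_left.1 hA.1 hv
      obtain ⟨C, hC, hvC⟩ := exists_isComponentOfDelete G (T := T) ⟨v, by simpa using hvT⟩
      have hCu := hC.isUnionOfComponents
      have hsub : C ⊆ A := by
        intro u hu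
        have huT : u ∉ T := Finset.disjoint_left.1 hCu.1 hu
        exact hA.mem_of_reachable ((hvC ⟨u, by simpa using huT⟩).1 hu) hv
      have hvmem : v ∈ C := (hvC ⟨v, by simpa using hvT⟩).2 (SimpleGraph.Reachable.refl _)
      have hdiff : IsUnionOfComponents G T (A \ C) := by
        refine ⟨hA.1.mono_left Finset.sdiff_subset, fun u hu w hw huw => ?_⟩
        rw [Finset.mem_sdiff] at hu ⊢
        refine ⟨hA.2 u hu.1 w hw huw, fun hwC => hu.2 ?_⟩
        exact hCu.2 w hwC u (Finset.disjoint_left.1 hA.1 hu.1) huw.symm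
      have hsum : separatorDerivation K T A =
          separatorDerivation K T (A \ C) + separatorDerivation K T C := by
        unfold separatorDerivation
        exact (Finset.sum_sdiff hsub).symm
      rw [hsum]
      refine Submodule.add_mem _ (ih _ (Finset.card_lt_card ?_) hdiff rfl)
        (Submodule.subset_span ⟨T, C, hT, hC, rfl⟩)
      exact Finset.sdiff_ssubset hsub ⟨v, hvmem⟩

/-- Deleting edges keeps a separator a separator, but may split a component into several. -/
theorem span_separatorBasedDerivations_anti {H : SimpleGraph V} (h : G ≤ H) :
    Submodule.span (MvPolynomial V K) (separatorBasedDerivations K H) ≤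
      Submodule.span (MvPolynomial V K) (separatorBasedDerivations K G) := by
  rw [Submodule.span_le]
  rintro _ ⟨T, C, hT, hC, rfl⟩
  exact separatorDerivation_mem_span (hT.mono h) (hC.isUnionOfComponents.mono h)

end Separators

/-! ### Adding a non-edge -/

section Deletion

variable {K : Type*} [Field K] {V : Type*} [Fintype V] {G : SimpleGraph V}

theorem _root_.MvPolynomial.sub_mem_of_forall_X {σ R A : Type*} [CommRing R] [CommRing A]
    [Algebra R A] (I : Ideal A) (φ ψ : MvPolynomial σ R →ₐ[R] A)
    (h : ∀ i, φ (X i) - ψ (X i) ∈ I) (p : MvPolynomial σ R) : φ p - ψ p ∈ I := by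
  rw [← Ideal.Quotient.mk_eq_mk_iff_sub_mem]
  have : (Ideal.Quotient.mkₐ R I).comp φ = (Ideal.Quotient.mkₐ R I).comp ψ := by
    apply algHom_ext
    intro i
    simpa using (Ideal.Quotient.mk_eq_mk_iff_sub_mem _ _).2 (h i)
  exact DFunLike.congr_fun this p

/-- Modulo `I` all variables off `T` become equal to `c`, so the difference vanishes along each edge
of a path avoiding `T`, and the differences telescope. -/
theorem map_sub_mem_of_reachable {R : Type*} [CommRing R] [Algebra K R]
    (φ : MvPolynomial V K →ₐ[K] R)
    (I : Ideal R) (c : R) {θ : Derivation K (MvPolynomial V K) (MvPolynomial V K)}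
    (hθ : θ ∈ logDerivations (graphicArrangement K G)) {T : Finset V}
    (hX : ∀ v, v ∉ T → φ (X v) - c ∈ I) {a b : ((T : Set V)ᶜ : Set V)}
    (h : (G.induce ((T : Set V)ᶜ)).Reachable a b) :
    φ (θ (X (a : V)) - θ (X (b : V))) ∈ I := by
  rw [mem_logDerivations_iff] at hθ
  obtain ⟨p⟩ := h
  induction p with
  | nil => simp
  | @cons a b c hab _ ih =>
    have h1 : φ (θ (X (a : V)) - θ (X (b : V))) ∈ I := by
      refine I.mem_of_dvd (map_dvd φ (hθ a b hab)) ?_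
      have := I.sub_mem (hX a fun h => a.2 h) (hX b fun h => b.2 h)
      rwa [sub_sub_sub_cancel_right, ← map_sub] at this
    have := I.add_mem h1 ih
    rwa [← map_add, sub_add_sub_cancel] at this

theorem exists_mem_span_separatorBasedDerivations_dvd {i j : V} (hij : i ≠ j)
    {θ : Derivation K (MvPolynomial V K) (MvPolynomial V K)}
    (hθ : θ ∈ logDerivations (graphicArrangement K G)) :
    ∃ δ ∈ Submodule.span (MvPolynomial V K) (separatorBasedDerivations K G),
      (X i - X j : MvPolynomial V K) ∣ (θ - δ) (X i) - (θ - δ) (X j) := by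
  classical
  -- This substitution identifies `x_j` with `x_i` and turns the monomial `∏ x_t` into the
  -- coefficient `∏ (x_i - x_t)` of a separator-based derivation; it is an involution modulo `x_i -
  -- x_j`.
  set φ := aeval (R := K) (fun t => if t = i ∨ t = j then X i else X i - X t :
    V → MvPolynomial V K) with hφ
  set g := φ (θ (X i) - θ (X j)) with hg
  have hX : ∀ (T : Finset V) (v : V), v ∉ T → φ (X v) - X i ∈
      Ideal.span (X '' {v | v ∉ T ∧ v ≠ i ∧ v ≠ j} : Set (MvPolynomial V K)) := by
    intro T v hv
    by_cases hvi : v = i ∨ v = j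
    · simp [hφ, hvi]
    · have h1 : φ (X v) - X i = - X v := by simp [hφ, hvi]
      push Not at hvi
      rw [h1]
      exact neg_mem (Ideal.subset_span ⟨v, ⟨hv, hvi⟩, rfl⟩)
  -- The variables of `m` other than `x_i`, `x_j` form a set `T` separating `i` from `j`: a path
  -- avoiding `T` would put `g` in the ideal of the variables outside `T ∪ {i, j}`, none of which
  -- divides `m`.
  have hmon : ∀ m ∈ g.support,
      ∃ δ ∈ Submodule.span (MvPolynomial V K) (separatorBasedDerivations K G),
        δ (X i) - δ (X j) = φ (monomial m (g.coeff m)) := by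
    intro m hm
    set T := Finset.univ.filter fun v => m v ≠ 0 ∧ v ≠ i ∧ v ≠ j with hT
    have hiT : i ∉ T := by simp [hT]
    have hjT : j ∉ T := by simp [hT]
    have hnr : ¬ (G.induce ((T : Set V)ᶜ)).Reachable ⟨i, by simpa using hiT⟩
        ⟨j, by simpa using hjT⟩ := by
      intro hr
      have hmem := map_sub_mem_of_reachable φ _ (X i) hθ (hX T) hr
      obtain ⟨v, ⟨hvT, hv⟩, hmv⟩ := mem_ideal_span_X_image.1 hmem m hm
      exact hvT (by simp [hT, hmv, hv])
    obtain ⟨C, hC, hiC⟩ := exists_isComponentOfDelete G (T := T) ⟨i, by simpa using hiT⟩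
    have hdvd : (∏ t ∈ T, (X i - X t) : MvPolynomial V K) ∣ φ (monomial m (g.coeff m)) := by
      have h1 : (∏ t ∈ T, (X i - X t) : MvPolynomial V K) = φ (∏ t ∈ T, X t) := by
        rw [map_prod]
        refine Finset.prod_congr rfl fun t ht => ?_
        have : ¬ (t = i ∨ t = j) := by
          simp only [hT, Finset.mem_filter] at ht
          tauto
        simp [hφ, this]
      rw [h1, monomial_eq, Finsupp.prod]
      refine map_dvd φ (Dvd.dvd.mul_left ?_ _)
      refine (Finset.prod_dvd_prod_of_dvd (s := T) X (fun v => X v ^ m v) ?_).trans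
        (Finset.prod_dvd_prod_of_subset T m.support _ ?_)
      · intro t ht
        exact dvd_pow_self _ (by simp only [hT, Finset.mem_filter] at ht; exact ht.2.1)
      · intro t ht
        simp only [hT, Finset.mem_filter] at ht
        exact Finsupp.mem_support_iff.2 ht.2.1
    obtain ⟨q, hq⟩ := hdvd
    have hi : i ∈ C := (hiC ⟨i, by simpa using hiT⟩).2 (SimpleGraph.Reachable.refl _)
    have hj : j ∉ C := fun h => hnr ((hiC ⟨j, by simpa using hjT⟩).1 h)
    refine ⟨q • separatorDerivation K T C, Submodule.smul_mem _ _ (Submodule.subset_span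
      ⟨T, C, fun h => hnr (h _ _), hC, rfl⟩), ?_⟩
    rw [hq]
    simp [hi, hj, mul_comm]
  choose! d hd hd' using hmon
  refine ⟨∑ m ∈ g.support, d m, Submodule.sum_mem _ hd, ?_⟩
  have hsum : (∑ m ∈ g.support, d m) (X i) - (∑ m ∈ g.support, d m) (X j) = φ g := by
    rw [Derivation.finset_sum_apply, Derivation.finset_sum_apply, ← Finset.sum_sub_distrib,
      Finset.sum_congr rfl hd', ← map_sum, support_sum_monomial_coeff]
  have hid : (AlgHom.id K _) (θ (X i) - θ (X j)) - (φ.comp φ) (θ (X i) - θ (X j)) ∈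
      Ideal.span {(X i - X j : MvPolynomial V K)} := by
    refine MvPolynomial.sub_mem_of_forall_X _ _ _ (fun t => ?_) _
    rw [Ideal.mem_span_singleton]
    by_cases hti : t = i
    · subst hti
      simp [hφ]
    · by_cases htj : t = j
      · subst htj
        simp [hφ, dvd_sub_comm]
      · simp [hφ, hti, htj]
  rw [Ideal.mem_span_singleton] at hid
  convert hid using 1
  rw [Derivation.sub_apply, Derivation.sub_apply, AlgHom.comp_apply, ← hg, ← hsum]
  simp only [AlgHom.id_apply]
  ring

theorem logDerivations_le_span (G : SimpleGraph V) :
    logDerivations (graphicArrangement K G) ≤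
      Submodule.span (MvPolynomial V K)
        ({θ | ∃ k < Fintype.card V, θ = powerDerivation K V k} ∪
          separatorBasedDerivations K G) := by
  classical
  -- Induction upwards in the order of graphs, ending at the complete graph.
  induction G using WellFoundedGT.induction with
  | _ G ih =>
    by_cases htop : G = ⊤
    · subst htop
      exact logDerivations_top_le_span.trans (Submodule.span_mono Set.subset_union_left)
    · obtain ⟨i, j, hij, hnadj⟩ : ∃ i j, i ≠ j ∧ ¬ G.Adj i j := by
        by_contra! h
        exact htop (top_le_iff.1 fun i j hij => h i j hij)
      intro θ hθ
      obtain ⟨δ, hδ, hdvd⟩ := exists_mem_span_separatorBasedDerivations_dvd hij hθ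
      have hlt : G < G ⊔ SimpleGraph.edge i j := by
        refine lt_of_le_of_ne le_sup_left fun h => hnadj ?_
        rw [h]
        simp [SimpleGraph.edge_adj, hij]
      have hδ' : δ ∈ logDerivations (graphicArrangement K G) := by
        refine (Submodule.span_le.2 ?_) hδ
        rintro _ ⟨T, C, _, hC, rfl⟩
        exact separatorDerivation_mem_logDerivations hC.isUnionOfComponents
      have hmem : θ - δ ∈ logDerivations (graphicArrangement K (G ⊔ SimpleGraph.edge i j)) := by
        have hsub := Submodule.sub_mem _ hθ hδ'
        rw [mem_logDerivations_iff] at hsub ⊢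
        intro a b hab
        rw [SimpleGraph.sup_adj, SimpleGraph.edge_adj] at hab
        rcases hab with hab | ⟨⟨rfl, rfl⟩ | ⟨rfl, rfl⟩, -⟩
        · exact hsub a b hab
        · exact hdvd
        · rwa [dvd_sub_comm, ← neg_sub, neg_dvd]
      have h1 := ih _ hlt hmem
      have h2 : θ - δ ∈ Submodule.span (MvPolynomial V K)
          ({θ | ∃ k < Fintype.card V, θ = powerDerivation K V k} ∪
            separatorBasedDerivations K G) := by
        rw [Submodule.span_union] at h1 ⊢
        exact sup_le_sup_left (span_separatorBasedDerivations_anti hlt.le) _ h1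
      have h3 := Submodule.add_mem _ h2 (Submodule.span_mono Set.subset_union_right hδ)
      rwa [sub_add_cancel] at h3

end Deletion

/-! ### Eliminating the powers above the connectivity -/

section PowerReduction

variable {K : Type*} [Field K] {V : Type*} [Fintype V] {G : SimpleGraph V}

theorem powerDerivation_mem_of_monic
    {N : Submodule (MvPolynomial V K) (Derivation K (MvPolynomial V K) (MvPolynomial V K))}
    {η : Derivation K (MvPolynomial V K) (MvPolynomial V K)} (hη : η ∈ N)
    {p : Polynomial (MvPolynomial V K)} (hp : p.Monic) (h : ∀ i, η (X i) = p.eval (X i))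
    (hlow : ∀ k < p.natDegree, powerDerivation K V k ∈ N) :
    powerDerivation K V p.natDegree ∈ N := by
  have hdeg : (Polynomial.X ^ p.natDegree - p).degree < (p.natDegree : WithBot ℕ) := by
    have h1 : (Polynomial.X ^ p.natDegree : Polynomial (MvPolynomial V K)).degree =
        (p.natDegree : WithBot ℕ) := Polynomial.degree_X_pow _
    rw [← h1]
    refine Polynomial.degree_sub_lt_left ?_ (by simp) ?_
    · rw [h1, Polynomial.degree_eq_natDegree hp.ne_zero]
    · rw [hp.leadingCoeff, Polynomial.leadingCoeff_X_pow]
  have hmem := mem_span_powerDerivation_of_eval (δ := powerDerivation K V p.natDegree - η)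
    _ hdeg fun i => by
      rw [Derivation.sub_apply, powerDerivation_X, h, Polynomial.eval_sub, Polynomial.eval_pow,
        Polynomial.eval_X]
  have hle : Submodule.span (MvPolynomial V K)
      {θ | ∃ k < p.natDegree, θ = powerDerivation K V k} ≤ N := by
    rw [Submodule.span_le]
    rintro _ ⟨k, hk, rfl⟩
    exact hlow k hk
  have := N.add_mem (hle hmem) hη
  rwa [sub_add_cancel] at this

/-- The sum over all components has coefficient `∏ (x_i - x_t)` at every vertex `i`, also for `i ∈
T`, where the product is zero. -/
theorem powerDerivation_mem_of_isSeparator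
    {N : Submodule (MvPolynomial V K) (Derivation K (MvPolynomial V K) (MvPolynomial V K))}
    (hN : separatorBasedDerivations K G ⊆ N) {T : Finset V} (hT : IsSeparator G T)
    (hlow : ∀ k < T.card, powerDerivation K V k ∈ N) :
    powerDerivation K V T.card ∈ N := by
  classical
  have hmem : separatorDerivation K T Tᶜ ∈ N := by
    refine Submodule.span_le.2 hN (separatorDerivation_mem_span hT ⟨?_, ?_⟩)
    · exact disjoint_compl_left
    · intro u _ v hv _
      simpa using hv
  have hdeg : (∏ t ∈ T, (Polynomial.X - Polynomial.C (X t : MvPolynomial V K))).natDegree =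
      T.card := by
    simp
  rw [← hdeg] at hlow ⊢
  refine powerDerivation_mem_of_monic hmem
    (Polynomial.monic_prod_of_monic _ _ fun t _ => Polynomial.monic_X_sub_C _) (fun i => ?_) hlow
  rw [separatorDerivation_X, Polynomial.eval_prod]
  by_cases hi : i ∈ T
  · rw [if_neg (by simpa using hi), Finset.prod_eq_zero hi (by simp)]
  · rw [if_pos (by simpa using hi)]
    simp

/-- Multiplying the derivation of the separator `V ∖ {i, j}` by `x_j - x_i` evaluates
a monic polynomial of degree `|V| - 1` at all vertices. -/
theorem powerDerivation_mem_of_not_adj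
    {N : Submodule (MvPolynomial V K) (Derivation K (MvPolynomial V K) (MvPolynomial V K))}
    (hN : separatorBasedDerivations K G ⊆ N) {T : Finset V} {i j : V} (hij : i ≠ j)
    (hmemT : ∀ v, v ∉ T ↔ v = i ∨ v = j) (hT : IsSeparator G T) (hadj : ¬ G.Adj j i)
    (hlow : ∀ k < T.card + 1, powerDerivation K V k ∈ N) :
    powerDerivation K V (T.card + 1) ∈ N := by
  classical
  have hunion : IsUnionOfComponents G T {j} := by
    refine ⟨by simpa using (hmemT j).2 (Or.inr rfl), fun u hu v hv huv => ?_⟩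
    rw [Finset.mem_singleton] at hu ⊢
    subst hu
    rcases (hmemT v).1 hv with rfl | rfl
    · exact absurd huv hadj
    · rfl
  have hmem : (X j - X i : MvPolynomial V K) • separatorDerivation K T {j} ∈ N :=
    N.smul_mem _ (Submodule.span_le.2 hN (separatorDerivation_mem_span hT hunion))
  have hmonic : (∏ t ∈ T, (Polynomial.X - Polynomial.C (X t : MvPolynomial V K))).Monic :=
    Polynomial.monic_prod_of_monic _ _ fun t _ => Polynomial.monic_X_sub_C _
  have hdeg : ((∏ t ∈ T, (Polynomial.X - Polynomial.C (X t : MvPolynomial V K))) *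
      (Polynomial.X - Polynomial.C (X i))).natDegree = T.card + 1 := by
    rw [hmonic.natDegree_mul (Polynomial.monic_X_sub_C _)]
    simp
  rw [← hdeg] at hlow ⊢
  refine powerDerivation_mem_of_monic hmem (hmonic.mul (Polynomial.monic_X_sub_C _))
    (fun v => ?_) hlow
  rw [Derivation.smul_apply, separatorDerivation_X, Polynomial.eval_mul, Polynomial.eval_prod]
  by_cases hv : v ∈ T
  · have hvj : v ≠ j := fun h => (hmemT v).2 (Or.inr h) hv
    simp only [Finset.mem_singleton, hvj, if_false, smul_zero]
    rw [Finset.prod_eq_zero hv (by simp), zero_mul]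
  · rcases (hmemT v).1 hv with rfl | rfl
    · simp [hij]
    · simp [mul_comm]

theorem powerDerivation_mem_span [Nonempty V] (m : ℕ) (hm : m < Fintype.card V) :
    powerDerivation K V m ∈ Submodule.span (MvPolynomial V K)
      ({θ | ∃ k : ℕ, k ≤ connectivity G ∧ θ = powerDerivation K V k} ∪
        separatorBasedDerivations K G) := by
  classical
  induction m using Nat.strong_induction_on with
  | _ m ih =>
    rcases le_or_gt m (connectivity G) with hle | hlt
    · exact Submodule.subset_span (Or.inl ⟨m, hle, rfl⟩)
    · have hlow : ∀ k < m, powerDerivation K V k ∈ Submodule.span (MvPolynomial V K)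
          ({θ | ∃ k : ℕ, k ≤ connectivity G ∧ θ = powerDerivation K V k} ∪
            separatorBasedDerivations K G) := fun k hk => ih k hk (hk.trans hm)
      have hN : separatorBasedDerivations K G ⊆ (Submodule.span (MvPolynomial V K)
          ({θ | ∃ k : ℕ, k ≤ connectivity G ∧ θ = powerDerivation K V k} ∪
            separatorBasedDerivations K G) : Set _) :=
        Set.subset_union_right.trans Submodule.subset_span
      obtain ⟨T, hT, hTcard⟩ := exists_isSeparator_card_le (G := G) (by omega)
      obtain ⟨⟨i, hi⟩, ⟨j, hj⟩, hnr⟩ := hT.exists_not_reachable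
      have hij : i ≠ j := by
        rintro rfl
        exact hnr (SimpleGraph.Reachable.refl _)
      have hadj : ¬ G.Adj j i := fun h => hnr (SimpleGraph.Adj.reachable (by simpa using h.symm))
      have hsep : ∀ T' : Finset V, T ⊆ T' → i ∉ T' → j ∉ T' → IsSeparator G T' :=
        fun T' hTT' hi' hj' hp => not_reachable_of_subset hTT' hi' hj' hnr (hp _ _)
      have hsub : T ⊆ (Finset.univ \ {i, j} : Finset V) := by
        intro v hv
        have h1 : v ≠ i := by rintro rfl; exact hi hv
        have h2 : v ≠ j := by rintro rfl; exact hj hv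
        simp [h1, h2]
      have hcard : (Finset.univ \ {i, j} : Finset V).card + 2 = Fintype.card V := by
        rw [← Finset.card_pair hij, Finset.card_sdiff_add_card_eq_card (Finset.subset_univ _),
          Finset.card_univ]
      rcases Nat.lt_or_ge (m + 1) (Fintype.card V) with h1 | h1
      -- For `m ≤ ℓ - 2`, the separator can be enlarged to `m` vertices while avoiding `i` and `j`.
      -- Only `m = ℓ - 1` needs the extra linear factor.
      · obtain ⟨T', hTT', hT'U, rfl⟩ := Finset.exists_subsuperset_card_eq hsub
          (n := m) (by omega) (by omega)
        refine powerDerivation_mem_of_isSeparator hN (hsep T' hTT' ?_ ?_) hlow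
        · intro h; simpa using hT'U h
        · intro h; simpa using hT'U h
      · have hm' : m = (Finset.univ \ {i, j} : Finset V).card + 1 := by omega
        rw [hm'] at hlow ⊢
        refine powerDerivation_mem_of_not_adj hN hij (fun v => ?_)
          (hsep _ hsub (by simp) (by simp)) hadj hlow
        simp only [Finset.mem_sdiff, Finset.mem_univ, true_and, not_not, Finset.mem_insert,
          Finset.mem_singleton]

theorem span_eq_logDerivations [Nonempty V] (G : SimpleGraph V) :
    Submodule.span (MvPolynomial V K)
      ({θ | ∃ k : ℕ, k ≤ connectivity G ∧ θ = powerDerivation K V k} ∪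
        separatorBasedDerivations K G) = logDerivations (graphicArrangement K G) := by
  apply le_antisymm
  · rw [Submodule.span_le]
    rintro _ (⟨k, _, rfl⟩ | ⟨T, C, _, hC, rfl⟩)
    · exact powerDerivation_mem_logDerivations G k
    · exact separatorDerivation_mem_logDerivations hC.isUnionOfComponents
  · refine (logDerivations_le_span G).trans ?_
    rw [Submodule.span_le]
    rintro θ (⟨k, hk, rfl⟩ | hθ)
    · exact powerDerivation_mem_span k hk
    · exact Submodule.subset_span (Or.inr hθ)

end PowerReduction

/-! ### Homogeneous parts and minimality -/

section Minimality

variable {K : Type*} [Field K] {V : Type*}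

attribute [local instance] MvPolynomial.gradedAlgebra in
theorem _root_.MvPolynomial.homogeneousComponent_mul_of_isHomogeneous {σ R : Type*}
    [CommSemiring R] {p q : MvPolynomial σ R} {d n : ℕ} (hq : q.IsHomogeneous d) :
    homogeneousComponent n (p * q) =
      if d ≤ n then homogeneousComponent (n - d) p * q else 0 := by
  have hdec : ∀ (r : MvPolynomial σ R) (k : ℕ),
      (DirectSum.decompose (homogeneousSubmodule σ R) r k : MvPolynomial σ R) =
        homogeneousComponent k r := fun r k => decomposition.decompose'_apply r k
  have := DirectSum.coe_decompose_mul_of_right_mem (homogeneousSubmodule σ R) n (a := p)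
    ((mem_homogeneousSubmodule d q).2 hq)
  rwa [hdec, hdec] at this

variable [Fintype V]

theorem finite_separatorBasedDerivations (G : SimpleGraph V) :
    (separatorBasedDerivations K G).Finite := by
  refine (Set.finite_range fun p : Finset V × Finset V =>
    separatorDerivation K p.1 p.2).subset ?_
  rintro _ ⟨T, C, _, _, rfl⟩
  exact ⟨(T, C), rfl⟩

/-- The degree `k` part of an element of the span of power derivations other than `θ_k` and of
separator-based derivations, all of which have degree at least `k`. -/
theorem exists_homogeneousComponent_eq {k : ℕ}
    {F : Set (Derivation K (MvPolynomial V K) (MvPolynomial V K))}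
    (hF : ∀ δ ∈ F, ∃ d, k ≤ d ∧ ∀ i, (δ (X i)).IsHomogeneous d)
    {δ : Derivation K (MvPolynomial V K) (MvPolynomial V K)}
    (hδ : δ ∈ Submodule.span (MvPolynomial V K)
      ({θ | ∃ j ≠ k, θ = powerDerivation K V j} ∪ F)) :
    ∃ η ∈ Submodule.span (MvPolynomial V K) {θ | ∃ j < k, θ = powerDerivation K V j},
      ∃ c ∈ Submodule.span K F,
        ∀ i, homogeneousComponent k (δ (X i)) = (η + c) (X i) := by
  -- Taking degree `k` parts is additive but not linear over the polynomial ring, so the induction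
  -- runs over sums of terms `r • x` with `x` a generator.
  induction hδ using Submodule.closure_induction with
  | zero => exact ⟨0, Submodule.zero_mem _, 0, Submodule.zero_mem _, by simp⟩
  | add x y _ _ hx hy =>
    obtain ⟨η, hη, c, hc, h⟩ := hx
    obtain ⟨η', hη', c', hc', h'⟩ := hy
    refine ⟨η + η', Submodule.add_mem _ hη hη', c + c', Submodule.add_mem _ hc hc', fun i => ?_⟩
    rw [Derivation.add_apply, map_add, h, h']
    simp only [Derivation.add_apply]
    ring
  | smul_mem r x hx =>
    rcases hx with ⟨j, hj, rfl⟩ | hx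
    · have hhom : ∀ i : V, (X i ^ j : MvPolynomial V K).IsHomogeneous j :=
        fun i => isHomogeneous_X_pow i j
      rcases lt_or_gt_of_ne hj with hlt | hgt
      · refine ⟨homogeneousComponent (k - j) r • powerDerivation K V j,
          Submodule.smul_mem _ _ (Submodule.subset_span ⟨j, hlt, rfl⟩), 0,
          Submodule.zero_mem _, fun i => ?_⟩
        simp [homogeneousComponent_mul_of_isHomogeneous (hhom i), hlt.le]
      · refine ⟨0, Submodule.zero_mem _, 0, Submodule.zero_mem _, fun i => ?_⟩
        simp [homogeneousComponent_mul_of_isHomogeneous (hhom i), hgt.not_ge]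
    · obtain ⟨d, hkd, hd⟩ := hF x hx
      rcases hkd.eq_or_lt with rfl | hlt
      -- When `x` has degree exactly `k`, only the constant term of `r` contributes.
      · refine ⟨0, Submodule.zero_mem _, coeff 0 r • x,
          Submodule.smul_mem _ _ (Submodule.subset_span hx), fun i => ?_⟩
        simp [homogeneousComponent_mul_of_isHomogeneous (hd i), C_mul']
      · refine ⟨0, Submodule.zero_mem _, 0, Submodule.zero_mem _, fun i => ?_⟩
        simp [homogeneousComponent_mul_of_isHomogeneous (hd i), hlt.not_ge]

/-- A dependence would give a monic polynomial of degree `k` with the `ℓ > k` distinct roots `x_i`.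
-/
theorem powerDerivation_notMem_span_lt {k : ℕ} (hk : k < Fintype.card V) :
    powerDerivation K V k ∉ Submodule.span (MvPolynomial V K)
      {θ | ∃ j < k, θ = powerDerivation K V j} := by
  intro h
  have key : ∀ δ ∈ Submodule.span (MvPolynomial V K) {θ | ∃ j < k, θ = powerDerivation K V j},
      ∃ p : Polynomial (MvPolynomial V K), p.degree < (k : WithBot ℕ) ∧
        ∀ i, δ (X i) = p.eval (X i) := by
    intro δ hδ
    induction hδ using Submodule.span_induction with
    | mem x hx =>
      obtain ⟨j, hj, rfl⟩ := hx
      exact ⟨Polynomial.X ^ j, by simpa using hj, by simp⟩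
    | zero => exact ⟨0, by simp, by simp⟩
    | add x y _ _ hx hy =>
      obtain ⟨p, hp, hpx⟩ := hx
      obtain ⟨q, hq, hqy⟩ := hy
      exact ⟨p + q, (Polynomial.degree_add_le _ _).trans_lt (max_lt hp hq), by simp [hpx, hqy]⟩
    | smul a x _ hx =>
      obtain ⟨p, hp, hpx⟩ := hx
      exact ⟨a • p, (Polynomial.degree_smul_le _ _).trans_lt hp, by simp [hpx]⟩
  obtain ⟨p, hp, hpX⟩ := key _ h
  have hmonic := Polynomial.monic_X_pow_sub (p := p) (n := k) hp
  have hzero : Polynomial.X ^ k - p = 0 := by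
    refine Polynomial.eq_zero_of_natDegree_lt_card_of_eval_eq_zero _
      (X_injective (σ := V) (R := K)) (fun i => ?_) ?_
    · rw [Polynomial.eval_sub, Polynomial.eval_pow, Polynomial.eval_X, ← hpX, powerDerivation_X,
        sub_self]
    · refine lt_of_le_of_lt (Polynomial.natDegree_le_of_degree_le ?_) hk
      refine (Polynomial.degree_sub_le _ _).trans (max_le (by simp) hp.le)
  exact hmonic.ne_zero hzero

/-- If `θ_k` can be dropped from a generating set, then so can one of the other elements. -/
theorem exists_mem_span_diff_singleton {k : ℕ} (hk : k < Fintype.card V)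
    {F : Finset (Derivation K (MvPolynomial V K) (MvPolynomial V K))}
    (hF : ∀ δ ∈ F, ∃ d, k ≤ d ∧ ∀ i, (δ (X i)).IsHomogeneous d)
    (h : powerDerivation K V k ∈ Submodule.span (MvPolynomial V K)
      ({θ | ∃ j ≠ k, θ = powerDerivation K V j} ∪ (F : Set _))) :
    ∃ δ ∈ F, δ ∈ Submodule.span (MvPolynomial V K)
      ({θ | ∃ j ≤ k, θ = powerDerivation K V j} ∪ ((F : Set _) \ {δ})) := by
  classical
  obtain ⟨η, hη, c, hc, heq⟩ := exists_homogeneousComponent_eq hF h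
  have heq' : powerDerivation K V k = η + c := by
    apply derivation_ext
    intro i
    rw [← heq, powerDerivation_X, homogeneousComponent_of_mem
      ((mem_homogeneousSubmodule _ _).2 (isHomogeneous_X_pow i k)), if_pos rfl]
  obtain ⟨a, -, rfl⟩ := Submodule.mem_span_finset.1 hc
  obtain ⟨δ, hδ, hne⟩ : ∃ δ ∈ F, a δ ≠ 0 := by
    by_contra! hall
    rw [Finset.sum_eq_zero fun δ hδ => by rw [hall δ hδ, zero_smul], add_zero] at heq'
    exact powerDerivation_notMem_span_lt hk (heq' ▸ hη)
  refine ⟨δ, hδ, ?_⟩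
  rw [← Finset.add_sum_erase _ _ hδ] at heq'
  -- The coefficient of `δ` is a nonzero scalar of `K`, so the relation can be solved for `δ`.
  have hδeq : δ = (C (a δ)⁻¹ : MvPolynomial V K) •
      (powerDerivation K V k - η - ∑ x ∈ F.erase δ, (C (a x) : MvPolynomial V K) • x) := by
    have h1 : ∀ x : Derivation K (MvPolynomial V K) (MvPolynomial V K),
        (C (a x) : MvPolynomial V K) • x = a x • x := fun x => by
      apply derivation_ext
      intro i
      simp [C_mul']
    have h2 : powerDerivation K V k - η - ∑ x ∈ F.erase δ, (C (a x) : MvPolynomial V K) • x =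
        (C (a δ) : MvPolynomial V K) • δ := by
      rw [heq', h1 δ, Finset.sum_congr rfl fun x _ => h1 x]
      abel
    rw [h2, smul_smul, ← C_mul, inv_mul_cancel₀ hne, C_1, one_smul]
  have hmem : (C (a δ)⁻¹ : MvPolynomial V K) •
      (powerDerivation K V k - η - ∑ x ∈ F.erase δ, (C (a x) : MvPolynomial V K) • x) ∈
        Submodule.span (MvPolynomial V K)
          ({θ | ∃ j ≤ k, θ = powerDerivation K V j} ∪ ((F : Set _) \ {δ})) := by
    refine Submodule.smul_mem _ _ (Submodule.sub_mem _ (Submodule.sub_mem _ ?_ ?_) ?_)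
    · exact Submodule.subset_span (Or.inl ⟨k, le_rfl, rfl⟩)
    · refine Submodule.span_mono ?_ hη
      rintro _ ⟨j, hj, rfl⟩
      exact Or.inl ⟨j, hj.le, rfl⟩
    · refine Submodule.sum_mem _ fun x hx => Submodule.smul_mem _ _ (Submodule.subset_span ?_)
      rw [Finset.mem_erase] at hx
      exact Or.inr ⟨hx.2, hx.1⟩
  rwa [← hδeq] at hmem

omit [Fintype V] in
theorem isHomogeneous_separatorDerivation_X (T C : Finset V) (i : V) :
    (separatorDerivation K T C (X i)).IsHomogeneous T.card := by
  classical
  rw [separatorDerivation_X]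
  split_ifs
  · rw [Finset.card_eq_sum_ones]
    exact IsHomogeneous.prod _ _ _ fun t _ => (isHomogeneous_X K i).sub (isHomogeneous_X K t)
  · exact isHomogeneous_zero _ _ _

end Minimality

end GraphicArrangement

/-! ### The main theorem -/

theorem theorem1 {K : Type*} [Field K] {V : Type*} [Fintype V]
    (G : SimpleGraph V) (hG : G.Connected) :
    ∃ F : Finset (Derivation K (MvPolynomial V K) (MvPolynomial V K)),
      (F : Set (Derivation K (MvPolynomial V K) (MvPolynomial V K))) ⊆
        GraphicArrangement.separatorBasedDerivations K G ∧
      GraphicArrangement.IsMinimalGeneratingSet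
        (GraphicArrangement.logDerivations (GraphicArrangement.graphicArrangement K G))
        ({θ | ∃ k : ℕ, k ≤ GraphicArrangement.connectivity G ∧
            θ = GraphicArrangement.powerDerivation K V k} ∪
          (F : Set (Derivation K (MvPolynomial V K) (MvPolynomial V K)))) := by
  classical
  have := hG.nonempty
  set N := GraphicArrangement.logDerivations (GraphicArrangement.graphicArrangement K G)
  set Θ : Set (Derivation K (MvPolynomial V K) (MvPolynomial V K)) :=
    {θ | ∃ k : ℕ, k ≤ GraphicArrangement.connectivity G ∧
      θ = GraphicArrangement.powerDerivation K V k} with hΘ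
  have hspan : Submodule.span (MvPolynomial V K)
      (Θ ∪ GraphicArrangement.separatorBasedDerivations K G) = N :=
    GraphicArrangement.span_eq_logDerivations G
  have hfin := GraphicArrangement.finite_separatorBasedDerivations (K := K) G
  obtain ⟨F, hF⟩ := exists_minimal_of_wellFoundedLT
    (fun F : Finset (Derivation K (MvPolynomial V K) (MvPolynomial V K)) =>
      (F : Set _) ⊆ GraphicArrangement.separatorBasedDerivations K G ∧
        Submodule.span (MvPolynomial V K) (Θ ∪ (F : Set _)) = N)
    ⟨hfin.toFinset, by simp, by simpa using hspan⟩
  obtain ⟨⟨hFsub, hFspan⟩, hFmin⟩ := hF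
  -- Minimality of `F` under inclusion: a redundant `δ` could be erased.
  have hirr : ∀ δ ∈ F, δ ∉ Submodule.span (MvPolynomial V K) (Θ ∪ ((F : Set _) \ {δ})) := by
    intro δ hδ hmem
    have hle := hFmin (y := F.erase δ) ⟨?_, ?_⟩ (Finset.erase_subset _ _)
    · exact Finset.notMem_erase δ F (hle hδ)
    · exact (Finset.coe_subset.2 (Finset.erase_subset _ _)).trans hFsub
    · rw [Finset.coe_erase]
      refine le_antisymm ?_ ?_
      · rw [← hFspan]
        exact Submodule.span_mono (Set.union_subset_union_right _ Set.sdiff_subset)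
      · rw [← hFspan, Submodule.span_le]
        rintro x (hx | hx)
        · exact Submodule.subset_span (Or.inl hx)
        · by_cases hxδ : x = δ
          · exact hxδ ▸ hmem
          · exact Submodule.subset_span (Or.inr ⟨hx, hxδ⟩)
  refine ⟨F, hFsub, hFspan, ?_⟩
  intro B hB hBsub b hb
  by_contra hbB
  have hbB' : b ∈ Submodule.span (MvPolynomial V K) B := by
    rw [hB, ← hFspan]
    exact Submodule.subset_span hb
  by_cases hbF : b ∈ F
  · refine hirr b hbF (Submodule.span_mono ?_ hbB')
    intro x hx
    rcases hBsub hx with h | h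
    · exact Or.inl h
    · exact Or.inr ⟨h, fun hxb => hbB (hxb ▸ hx)⟩
  · obtain ⟨k, hk, rfl⟩ := hb.resolve_right hbF
    have hkcard : k < Fintype.card V :=
      hk.trans_lt (GraphicArrangement.isGreatest_connectivity G).1.1
    obtain ⟨δ, hδ, hδmem⟩ := GraphicArrangement.exists_mem_span_diff_singleton hkcard (F := F)
      (fun δ hδ => by
        obtain ⟨T, C, hT, _, rfl⟩ := hFsub hδ
        exact ⟨T.card, hk.trans (GraphicArrangement.card_ge_connectivity_of_isSeparator hT),
          GraphicArrangement.isHomogeneous_separatorDerivation_X T C⟩)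
      (Submodule.span_mono (fun x hx => by
        rcases hBsub hx with ⟨j, _, rfl⟩ | h
        · exact Or.inl ⟨j, fun hjk => hbB (hjk ▸ hx), rfl⟩
        · exact Or.inr h) hbB')
    refine hirr δ hδ (Submodule.span_mono ?_ hδmem)
    rintro x (⟨j, hj, rfl⟩ | h)
    · exact Or.inl ⟨j, hj.trans hk, rfl⟩
    · exact Or.inr h
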